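/- Let $G$ be a finite tree on $k\ge 2$ vertices with vertex set $V$, and fix an arbitrary orientation of its edges. Each oriented edge $e=(x,y)$ acts on the words of length $n$ over the alphabet $V$ recursively by $e(xw)=y\,e(w)$, $e(yw)=xw$, and $e(zw)=zw$ for $z\ne x,y$ (and $e(\emptyset)=\emptyset$). For $n\ge 1$, let $\Gamma_n^G$ be the $n$-th Schreier graph of the corresponding tree automaton group: the multigraph (loops and parallel edges allowed) with vertex set $V^n$ that has, for each edge $e$ of $G$ and each $w\in V^n$, exactly one edge, joining $w$ to $e(w)$. Let $T(H,x,y)$ denote the Tutte polynomial of a finite multigraph $H$, defined recursively by $T(H,x,y)=1$ if $H$ has no edges, $T(H,x,y)=x\,T(H\setminus e,x,y)$ if $e$ is a bridge, $T(H,x,y)=y\,T(H\setminus e,x,y)$ if $e$ is a loop, and $T(H,x,y)=T(H\setminus e,x,y)+T(H/e,x,y)$ for any other edge $e$. Then $$ T(\Gamma_n^G,x,y)= y^{(k-1)(k-2)k^{n-1}}\cdot\left(y+x+\cdots+x^{2^n-1}\right)^{k-1}\cdot\prod_{i=1}^{n-1}\left(y+x+\cdots+x^{2^i-1}\right)^{(k-1)(k-2)k^{n-i-1}},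 $$ where $y+x+\cdots+x^{m-1}$ stands for $y+\sum_{j=1}^{m-1}x^j$ (so it is $y+x$ for $m=2$). This holds whatever edges are chosen in the recursion. -/

import Mathlib

/-- A transducer with states `Q` over the alphabet `X`. -/
structure Transducer (Q X : Type*) where
  /-- The restriction map: the state entered after reading a letter. -/
  restriction : Q → X → Q
  /-- The output map. -/
  output : Q → X → X

namespace Transducer

variable {Q X E : Type*}

/-- The action of a state on words of length `n`: the first letter `w 0` is replaced by
`output q (w 0)`, and the state `restriction q (w 0)` acts on the remaining word. -/
def act (A : Transducer Q X) : (n : ℕ) → Q → (Fin n → X) → (Fin n → X)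
  | 0, _, w => w
  | n + 1, q, w =>
    Fin.cons (A.output q (w 0)) (A.act n (A.restriction q (w 0)) (Fin.tail w))

/-- The `n`-th Schreier multigraph of a transducer, for a family `s : E → Q` of generating
states: the vertices are the words of length `n`, and each pair `(e, w)` is one edge,
labelled by `e`, joining `w` to its image under the state `s e`. -/
def schreierGraph (A : Transducer Q X) (s : E → Q) (n : ℕ) :
    Graph (Fin n → X) (E × (Fin n → X)) where
  vertexSet := Set.univ
  edgeSet := Set.univ
  IsLink e u v := s(u, v) = s(e.2, A.act n (s e.1) e.2)
  isLink_symm _ _ := ⟨fun _ _ h => Sym2.eq_swap.trans h⟩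
  eq_or_eq_of_isLink_of_isLink := by
    intro e x y v w h h'
    have h2 := h.trans h'.symm
    rw [Sym2.eq_iff] at h2
    rcases h2 with h2 | h2
    · exact Or.inl h2.1
    · exact Or.inr h2.1
  edge_mem_iff_exists_isLink e := ⟨fun _ => ⟨_, _, rfl⟩, fun _ => Set.mem_univ _⟩
  left_mem_of_isLink _ _ _ _ := Set.mem_univ _

end Transducer

namespace SimpleGraph

variable {V : Type*}

/-- A choice of an orientation of every edge of `G`; `o.arc e = (x, y)` means that the edge `e`
is oriented from `x` to `y`. -/
structure EdgeOrientation (G : SimpleGraph V) where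
  /-- The ordered pair chosen for an edge. -/
  arc : G.edgeSet → V × V
  /-- The chosen pair consists of the two ends of the edge. -/
  mk_arc : ∀ e : G.edgeSet, s((arc e).1, (arc e).2) = (e : Sym2 V)

variable [DecidableEq V] {G : SimpleGraph V}

/-- The graph automaton of an oriented graph. Its states are the oriented edges `some e` and
the sink `none`. An oriented edge `e = (x, y)` exchanges the letters `x` and `y` and fixes all
others; its restriction is `e` itself at the letter `x` and the sink at every other letter. -/
def graphAutomaton (o : G.EdgeOrientation) : Transducer (Option G.edgeSet) V where
  restriction q z :=
    match q with
    | none => none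
    | some e => if z = (o.arc e).1 then some e else none
  output q z :=
    match q with
    | none => z
    | some e =>
      if z = (o.arc e).1 then (o.arc e).2 else if z = (o.arc e).2 then (o.arc e).1 else z

/-- The `n`-th Schreier graph of the graph automaton of `G`, with respect to the generators given
by the oriented edges of `G` (the sink acts trivially and contributes no edges). -/
def automatonSchreierGraph (o : G.EdgeOrientation) (n : ℕ) :
    Graph (Fin n → V) (G.edgeSet × (Fin n → V)) :=
  (graphAutomaton o).schreierGraph some n

end SimpleGraph

namespace Graph

variable {α β : Type*}

/-- An edge is a bridge if its ends are not connected by a path once it is deleted. -/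
def IsBridge (G : Graph α β) (e : β) : Prop :=
  ∃ x y, G.IsLink e x y ∧ ¬ Relation.ReflTransGen (G.deleteEdges {e}).Adj x y

open Classical in
/-- The contraction of an edge `e` with ends `x` and `y`: delete `e` and identify `y` with `x`. -/
noncomputable def contractEdge (G : Graph α β) (e : β) (x y : α) : Graph α β :=
  (G.deleteEdges {e}).map (fun v => if v = y then x else v)

/-- `G.IsTuttePolynomial p`: the polynomial `p` (with `X 0` for `x` and `X 1` for `y`) is obtained
from the multigraph `G` by the deletion-contraction recursion of the Tutte polynomial, with the
edges treated in some order. -/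
inductive IsTuttePolynomial : Graph α β → MvPolynomial (Fin 2) ℤ → Prop
  | edgeless (G : Graph α β) : G.edgeSet = ∅ → IsTuttePolynomial G 1
  | bridge (G : Graph α β) (e : β) (p : MvPolynomial (Fin 2) ℤ) :
      G.IsBridge e → IsTuttePolynomial (G.deleteEdges {e}) p →
      IsTuttePolynomial G (MvPolynomial.X 0 * p)
  | loop (G : Graph α β) (e : β) (x : α) (p : MvPolynomial (Fin 2) ℤ) :
      G.IsLoopAt e x → IsTuttePolynomial (G.deleteEdges {e}) p →
      IsTuttePolynomial G (MvPolynomial.X 1 * p)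
  | ordinary (G : Graph α β) (e : β) (x y : α) (p q : MvPolynomial (Fin 2) ℤ) :
      G.IsLink e x y → x ≠ y → ¬ G.IsBridge e →
      IsTuttePolynomial (G.deleteEdges {e}) p → IsTuttePolynomial (G.contractEdge e x y) q →
      IsTuttePolynomial G (p + q)

end Graph

/-- The polynomial `y + x + x ^ 2 + ⋯ + x ^ (m - 1)`, with `X 0` for `x` and `X 1` for `y`. -/
noncomputable def cyclePolynomial (m : ℕ) : MvPolynomial (Fin 2) ℤ :=
  MvPolynomial.X 1 + ∑ j ∈ Finset.Ico 1 m, MvPolynomial.X 0 ^ j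

/-! The Schreier graph is a cactus without bridges. An oriented edge `e = (x, y)` acts on the
longest prefix over `{x, y}` as a binary adding machine, so a word whose prefix has length `i` lies
in an `e`-orbit of size `2 ^ i`, and this orbit is a circuit of the graph. Because `G` is a tree,
the cycle matroid is the direct sum of these circuits. The Tutte polynomial is then the product of
`y + x + ⋯ + x ^ (m - 1)` over the circuits, `m` being the length.

Three ingredients carry this. `IsCircuitSum` describes direct sums of circuits and bridges; the
class is closed under the deletions and contractions of the recursion, and the product formula
satisfies each rule, so the order of the edges is irrelevant (`isTuttePolynomial_iff`). The orbits
of `e` are the nonempty fibres of `prefixRep`, and `exists_orbit_retraction` collapses every edge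
outside a given orbit while fixing that orbit, so no other path can replace a piece of the circuit.
Finally `prod_ncard_setOf_prefixRep_eq` counts orbits by length: a prefix of length `i < n` is
followed by one of `k - 2` letters and then by `n - i - 1` arbitrary ones. -/

namespace Graph

/-! ### Connectivity through edge sets, under deletion and contraction. -/

variable {α β ι : Type*}

/-- Two vertices are joined through a set `A` of edges. -/
def Joined (G : Graph α β) (A : Set β) : α → α → Prop :=
  Relation.ReflTransGen fun u v => ∃ f ∈ A, G.IsLink f u v

lemma Joined.symm {G : Graph α β} {A : Set β} {u v : α} (h : G.Joined A u v) :
    G.Joined A v u :=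
  haveI : Std.Symm fun u v => ∃ f ∈ A, G.IsLink f u v :=
    ⟨fun _ _ ⟨f, hf, hl⟩ => ⟨f, hf, hl.symm⟩⟩
  Relation.ReflTransGen.stdSymm.symm _ _ h

lemma IsLink.joined {G : Graph α β} {A : Set β} {f : β} {u v : α} (h : G.IsLink f u v)
    (hf : f ∈ A) : G.Joined A u v :=
  Relation.ReflTransGen.single ⟨f, hf, h⟩

lemma joined_empty_iff {G : Graph α β} {u v : α} : G.Joined ∅ u v ↔ u = v := by
  refine ⟨fun h => ?_, fun h => h ▸ Relation.ReflTransGen.refl⟩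
  induction h with
  | refl => rfl
  | tail _ h _ => obtain ⟨f, hf, _⟩ := h; exact hf.elim

/-- The ends of the edge `e` are joined through the set `A` of edges. -/
def Spans (G : Graph α β) (A : Set β) (e : β) : Prop :=
  ∃ x y, G.IsLink e x y ∧ G.Joined A x y

lemma IsLink.spans_iff {G : Graph α β} {A : Set β} {e : β} {x y : α} (h : G.IsLink e x y) :
    G.Spans A e ↔ G.Joined A x y := by
  refine ⟨?_, fun h' => ⟨x, y, h, h'⟩⟩
  rintro ⟨u, v, huv, hj⟩
  rcases huv.eq_and_eq_or_eq_and_eq h with ⟨rfl, rfl⟩ | ⟨rfl, rfl⟩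
  · exact hj
  · exact hj.symm

lemma deleteEdges_isLink_iff {G : Graph α β} {F : Set β} {e : β} {x y : α} :
    (G.deleteEdges F).IsLink e x y ↔ G.IsLink e x y ∧ e ∉ F := Iff.rfl

lemma deleteEdges_joined_iff {G : Graph α β} {F A : Set β} (hA : Disjoint A F) {u v : α} :
    (G.deleteEdges F).Joined A u v ↔ G.Joined A u v := by
  have : (fun u v => ∃ f ∈ A, (G.deleteEdges F).IsLink f u v) =
      fun u v => ∃ f ∈ A, G.IsLink f u v := by
    ext u v
    simp only [deleteEdges_isLink_iff]
    exact ⟨fun ⟨f, hf, h, _⟩ => ⟨f, hf, h⟩,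
      fun ⟨f, hf, h⟩ => ⟨f, hf, h, Set.disjoint_left.1 hA hf⟩⟩
  simp only [Joined, this]

lemma deleteEdges_spans_iff {G : Graph α β} {F A : Set β} (hA : Disjoint A F) {e : β}
    (he : e ∉ F) : (G.deleteEdges F).Spans A e ↔ G.Spans A e := by
  simp only [Spans, deleteEdges_joined_iff hA, deleteEdges_isLink_iff, he, not_false_eq_true,
    and_true]

lemma isBridge_iff_not_spans {G : Graph α β} {e : β} (he : e ∈ G.edgeSet) :
    G.IsBridge e ↔ ¬ G.Spans (G.edgeSet \ {e}) e := by
  have hrel : (G.deleteEdges {e}).Adj = fun u v => ∃ f ∈ G.edgeSet \ {e}, G.IsLink f u v := by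
    ext u v
    simp only [Adj, deleteEdges_isLink_iff]
    exact ⟨fun ⟨f, h, hf⟩ => ⟨f, ⟨h.edge_mem, hf⟩, h⟩, fun ⟨f, hf, h⟩ => ⟨f, h, hf.2⟩⟩
  obtain ⟨x, y, hxy⟩ := exists_isLink_of_mem_edgeSet he
  rw [IsBridge, hrel]
  constructor
  · rintro ⟨u, v, huv, hn⟩ hs
    exact hn ((huv.spans_iff).1 hs)
  · intro hs
    exact ⟨x, y, hxy, fun h => hs ⟨x, y, hxy, h⟩⟩

section contract

variable {G : Graph α β} {f : β} {x y : α}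

lemma contractEdge_isLink_iff {e : β} {u v : α} :
    (G.contractEdge f x y).IsLink e u v ↔ ∃ u' v', G.IsLink e u' v' ∧ e ≠ f ∧
      (open Classical in (if u' = y then x else u')) = u ∧
      (open Classical in (if v' = y then x else v')) = v := by
  simp only [contractEdge, map, Relation.Map, deleteEdges_isLink_iff, Set.mem_singleton_iff,
    and_assoc, ne_eq]

lemma IsLink.joined_of_eq (hf : G.IsLink f x y) {A : Set β} (hfA : f ∈ A) {u v : α}
    (h : (open Classical in (if u = y then x else u)) =
      (open Classical in (if v = y then x else v))) : G.Joined A u v := by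
  have hj : G.Joined A x y := hf.joined hfA
  split_ifs at h with h1 h2 h2
  · subst h1; subst h2; exact .refl
  · subst h1; subst h; exact hj.symm
  · subst h2; subst h; exact hj
  · subst h; exact .refl

/-- Identifying the ends of `f` has the same effect on connectivity as making `f` freely available.
-/
lemma IsLink.contractEdge_joined_iff (hf : G.IsLink f x y) {A : Set β} (hfA : f ∉ A) {u v : α} :
    (G.contractEdge f x y).Joined A (open Classical in (if u = y then x else u))
      (open Classical in (if v = y then x else v)) ↔ G.Joined (insert f A) u v := by
  classical
  constructor
  · intro h
    -- A path in the quotient lifts only up to the identification of `x` and `y`, so the induction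
    -- covers every preimage of its end; `f` itself bridges the gaps.
    have key : ∀ q, (G.contractEdge f x y).Joined A (if u = y then x else u) q →
        ∀ w, (if w = y then x else w) = q → G.Joined (insert f A) u w := by
      intro q hq
      induction hq with
      | refl => exact fun w hw => hf.joined_of_eq (Set.mem_insert _ _) (by convert hw.symm)
      | tail _ hs ih =>
        rintro w rfl
        obtain ⟨e, heA, hl⟩ := hs
        obtain ⟨u', v', hl, -, h1, h2⟩ := contractEdge_isLink_iff.1 hl
        have h3 := ih u' (by convert h1)
        have h4 : G.Joined (insert f A) u' v' := hl.joined (Set.mem_insert_of_mem _ heA)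
        have h5 : G.Joined (insert f A) v' w :=
          hf.joined_of_eq (Set.mem_insert _ _) (by convert h2)
        exact (h3.trans h4).trans h5
    exact key _ (by convert h) v rfl
  · intro h
    induction h with
    | refl => exact .refl
    | @tail b c _ hs ih =>
      refine ih.trans ?_
      obtain ⟨e, heA, hl⟩ := hs
      by_cases hef : e = f
      · subst hef
        rcases hl.eq_and_eq_or_eq_and_eq hf with ⟨rfl, rfl⟩ | ⟨rfl, rfl⟩
        · simp only [if_true, ite_self]; exact .refl
        · simp only [if_true, ite_self]; exact .refl
      · exact IsLink.joined (f := e) (contractEdge_isLink_iff.2 ⟨b, c, hl, hef, rfl, rfl⟩)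
          (heA.resolve_left hef)

lemma IsLink.contractEdge_spans_iff (hf : G.IsLink f x y) {A : Set β} (hfA : f ∉ A) {e : β}
    (he : e ∈ G.edgeSet) (hef : e ≠ f) :
    (G.contractEdge f x y).Spans A e ↔ G.Spans (insert f A) e := by
  obtain ⟨u, v, huv⟩ := exists_isLink_of_mem_edgeSet he
  have hc : (G.contractEdge f x y).IsLink e _ _ :=
    contractEdge_isLink_iff.2 ⟨u, v, huv, hef, rfl, rfl⟩
  rw [huv.spans_iff, hc.spans_iff, hf.contractEdge_joined_iff hfA]

end contract

/-! ### Direct sums of circuits and bridges, and their Tutte polynomials. -/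

/-- The edges of `G` fall into classes by their colour, the classes with colour in `S` are
circuits, the edges of the other classes are bridges, and the cycle matroid of `G` is the
direct sum of these classes. -/
structure IsCircuitSum (G : Graph α β) (c : β → ι) (S : Set ι) : Prop where
  -- An empty class must count as bridges, with factor `x ^ 0 = 1`: the value `cyclePolynomial 0` is
  -- `y`.
  exists_edge : ∀ i ∈ S, ∃ e ∈ G.edgeSet, c e = i
  spans_iff : ∀ e ∈ G.edgeSet, ∀ A ⊆ G.edgeSet \ {e},
    (G.Spans A e ↔ c e ∈ S ∧ ∀ f ∈ G.edgeSet, f ≠ e → c f = c e → f ∈ A)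

/-- The set of edges of a given colour. -/
def colourClass (G : Graph α β) (c : β → ι) (i : ι) : Set β := {e ∈ G.edgeSet | c e = i}

open Classical in
/-- The Tutte polynomial of a graph whose cycle matroid is a sum of circuits and bridges. -/
noncomputable def circuitSumPolynomial [Fintype ι] (G : Graph α β) (c : β → ι) (S : Set ι) :
    MvPolynomial (Fin 2) ℤ :=
  ∏ i, if i ∈ S then cyclePolynomial (G.colourClass c i).ncard
    else MvPolynomial.X 0 ^ (G.colourClass c i).ncard

lemma colourClass_deleteEdges (G : Graph α β) (c : β → ι) (i : ι) (e : β) :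
    (G.deleteEdges {e}).colourClass c i = G.colourClass c i \ {e} := by
  ext f
  change (f ∈ G.edgeSet \ {e} ∧ _) ↔ (f ∈ G.edgeSet ∧ _) ∧ _
  simp only [Set.mem_sdiff]
  tauto

lemma colourClass_contractEdge (G : Graph α β) (c : β → ι) (i : ι) (e : β) (x y : α) :
    (G.contractEdge e x y).colourClass c i = G.colourClass c i \ {e} := by
  ext f
  change (f ∈ G.edgeSet \ {e} ∧ _) ↔ (f ∈ G.edgeSet ∧ _) ∧ _
  simp only [Set.mem_sdiff]
  tauto

/-- Deleting or contracting `e` affects only the factor of its own class; `R` is the common product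
over the other classes. -/
lemma exists_circuitSumPolynomial_eq [Fintype ι] {G : Graph α β} (c : β → ι) (S : Set ι)
    (hfin : G.edgeSet.Finite) {e : β} (he : e ∈ G.edgeSet) :
    ∃ (m : ℕ) (R : MvPolynomial (Fin 2) ℤ), (G.colourClass c (c e)).ncard = m + 1 ∧
      G.circuitSumPolynomial c S =
        (open Classical in if c e ∈ S then cyclePolynomial (m + 1)
          else MvPolynomial.X 0 ^ (m + 1)) * R ∧
      (G.deleteEdges {e}).circuitSumPolynomial c (S \ {c e}) = MvPolynomial.X 0 ^ m * R ∧
      ∀ x y, (G.contractEdge e x y).circuitSumPolynomial c S =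
        (open Classical in if c e ∈ S then cyclePolynomial m
          else MvPolynomial.X 0 ^ m) * R := by
  classical
  have hmem : e ∈ G.colourClass c (c e) := ⟨he, rfl⟩
  have hf : (G.colourClass c (c e)).Finite := hfin.subset fun _ ha => ha.1
  have hcard := Set.ncard_sdiff_singleton_add_one hmem hf
  have hother : ∀ i ≠ c e, G.colourClass c i \ {e} = G.colourClass c i := fun i hi =>
    Set.sdiff_singleton_eq_self fun h => hi h.2.symm
  refine ⟨(G.colourClass c (c e) \ {e}).ncard, ∏ i ∈ Finset.univ.erase (c e),
    if i ∈ S then cyclePolynomial (G.colourClass c i).ncard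
      else MvPolynomial.X 0 ^ (G.colourClass c i).ncard, hcard.symm, ?_, ?_, fun x y => ?_⟩
  · rw [circuitSumPolynomial, ← Finset.mul_prod_erase _ _ (Finset.mem_univ (c e)), hcard]
  · rw [circuitSumPolynomial, ← Finset.mul_prod_erase _ _ (Finset.mem_univ (c e)),
      if_neg (fun h => h.2 rfl), colourClass_deleteEdges]
    congr 1
    refine Finset.prod_congr rfl fun i hi => ?_
    have hi' : i ≠ c e := Finset.ne_of_mem_erase hi
    rw [colourClass_deleteEdges, hother i hi']
    simp [hi']
  · rw [circuitSumPolynomial, ← Finset.mul_prod_erase _ _ (Finset.mem_univ (c e)),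
      colourClass_contractEdge]
    congr 1
    refine Finset.prod_congr rfl fun i hi => ?_
    rw [colourClass_contractEdge, hother i (Finset.ne_of_mem_erase hi)]

namespace IsCircuitSum

variable {G : Graph α β} {c : β → ι} {S : Set ι}

lemma isBridge_iff (h : G.IsCircuitSum c S) {e : β} (he : e ∈ G.edgeSet) :
    G.IsBridge e ↔ c e ∉ S := by
  rw [isBridge_iff_not_spans he, h.spans_iff e he _ subset_rfl]
  refine not_congr ⟨And.left, fun h' => ⟨h', fun f hf hne _ => ⟨hf, hne⟩⟩⟩

/-- A circuit that loses an edge becomes a path of bridges, so its colour leaves `S`. -/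
lemma deleteEdges (h : G.IsCircuitSum c S) {e : β} (he : e ∈ G.edgeSet) :
    (G.deleteEdges {e}).IsCircuitSum c (S \ {c e}) where
  exists_edge := by
    rintro i ⟨hi, hne⟩
    obtain ⟨f, hf, rfl⟩ := h.exists_edge i hi
    exact ⟨f, ⟨hf, fun hfe => hne (congrArg c hfe)⟩, rfl⟩
  spans_iff := by
    intro g hg A hA
    have hg' : g ∈ G.edgeSet := hg.1
    have hge : g ≠ e := hg.2
    have heA : e ∉ A := fun h' => (hA h').1.2 rfl
    rw [deleteEdges_spans_iff (by simpa using heA) (by simpa using hge),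
      h.spans_iff g hg' A fun a ha => ⟨(hA ha).1.1, (hA ha).2⟩]
    constructor
    · rintro ⟨h1, h2⟩
      refine ⟨⟨h1, fun hc => ?_⟩, fun f hf => h2 f hf.1⟩
      exact heA (h2 e he hge.symm (Eq.symm hc))
    · rintro ⟨h1, h2⟩
      refine ⟨h1.1, fun f hf hne hc => h2 f ⟨hf, fun hfe => h1.2 ?_⟩ hne hc⟩
      rw [Set.mem_singleton_iff.1 hfe] at hc
      exact hc.symm

/-- A circuit stays a circuit, one edge shorter. It cannot become empty, since a circuit with a
single edge is a loop, contrary to `x ≠ y`. -/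
lemma contractEdge (h : G.IsCircuitSum c S) {e : β} {x y : α} (hxy : G.IsLink e x y)
    (hne : x ≠ y) : (G.contractEdge e x y).IsCircuitSum c S where
  exists_edge := by
    intro i hi
    obtain ⟨f, hf, rfl⟩ := h.exists_edge i hi
    by_cases hfe : f = e
    · subst hfe
      by_contra hcon
      refine hne (joined_empty_iff.1 ((hxy.spans_iff).1
        ((h.spans_iff f hf ∅ (Set.empty_subset _)).2 ⟨hi, fun g hg hgf hc => ?_⟩)))
      exact hcon ⟨g, ⟨hg, hgf⟩, hc⟩
    · exact ⟨f, ⟨hf, hfe⟩, rfl⟩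
  spans_iff := by
    intro g hg A hA
    have hg' : g ∈ G.edgeSet := hg.1
    have hge : g ≠ e := hg.2
    have heA : e ∉ A := fun h' => (hA h').1.2 rfl
    rw [hxy.contractEdge_spans_iff heA hg' hge, h.spans_iff g hg' (insert e A) ?_]
    · refine and_congr_right fun _ => ⟨fun h2 f hf hfg hc => ?_, fun h2 f hf hfg hc => ?_⟩
      · exact (h2 f hf.1 hfg hc).resolve_left hf.2
      · by_cases hfe : f = e
        · exact Or.inl hfe
        · exact Or.inr (h2 f ⟨hf, hfe⟩ hfg hc)
    · rintro a (rfl | ha)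
      · exact ⟨hxy.edge_mem, hge.symm⟩
      · exact ⟨(hA ha).1.1, (hA ha).2⟩

lemma circuitSumPolynomial_of_edgeSet_eq_empty [Fintype ι] (h : G.IsCircuitSum c S)
    (hG : G.edgeSet = ∅) : G.circuitSumPolynomial c S = 1 := by
  refine Finset.prod_eq_one fun i _ => ?_
  have hi : i ∉ S := by
    intro hi
    obtain ⟨e, he, _⟩ := h.exists_edge i hi
    rw [hG] at he
    exact he
  rw [if_neg hi]
  simp [colourClass, hG]

lemma circuitSumPolynomial_of_isBridge [Fintype ι] (h : G.IsCircuitSum c S)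
    (hfin : G.edgeSet.Finite) {e : β} (he : e ∈ G.edgeSet) (hb : G.IsBridge e) :
    G.circuitSumPolynomial c S =
      MvPolynomial.X 0 * (G.deleteEdges {e}).circuitSumPolynomial c (S \ {c e}) := by
  obtain ⟨m, R, -, h1, h2, -⟩ := exists_circuitSumPolynomial_eq c S hfin he
  rw [h1, h2, if_neg ((h.isBridge_iff he).1 hb)]
  ring

lemma circuitSumPolynomial_of_isLoopAt [Fintype ι] (h : G.IsCircuitSum c S)
    (hfin : G.edgeSet.Finite) {e : β} {x : α} (hl : G.IsLoopAt e x) :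
    G.circuitSumPolynomial c S =
      MvPolynomial.X 1 * (G.deleteEdges {e}).circuitSumPolynomial c (S \ {c e}) := by
  obtain ⟨m, R, hm, h1, h2, -⟩ := exists_circuitSumPolynomial_eq c S hfin hl.edge_mem
  obtain ⟨hS, hall⟩ := (h.spans_iff e hl.edge_mem ∅ (Set.empty_subset _)).1 ⟨x, x, hl, .refl⟩
  have hsub : G.colourClass c (c e) ⊆ {e} := fun f hf => by
    by_contra hfe
    exact hall f hf.1 hfe hf.2
  have hm0 : m = 0 := by
    have := Set.ncard_le_ncard hsub
    rw [Set.ncard_singleton] at this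
    omega
  subst hm0
  rw [h1, h2, if_pos hS]
  simp [cyclePolynomial]

/-- For a circuit of length at least two, deletion contributes the top power of `x` and contraction
the sum of the remaining terms. -/
lemma circuitSumPolynomial_of_ordinary [Fintype ι] (h : G.IsCircuitSum c S)
    (hfin : G.edgeSet.Finite) {e : β} {x y : α} (hl : G.IsLink e x y) (hne : x ≠ y)
    (hb : ¬ G.IsBridge e) :
    G.circuitSumPolynomial c S =
      (G.deleteEdges {e}).circuitSumPolynomial c (S \ {c e}) +
        (G.contractEdge e x y).circuitSumPolynomial c S := by
  obtain ⟨m, R, hm, h1, h2, h3⟩ := exists_circuitSumPolynomial_eq c S hfin hl.edge_mem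
  have hS : c e ∈ S := not_not.1 (mt (h.isBridge_iff hl.edge_mem).2 hb)
  obtain ⟨m, rfl⟩ : ∃ m', m = m' + 1 := by
    refine Nat.exists_eq_succ_of_ne_zero fun hm0 => hne ?_
    rw [hm0, Nat.zero_add, Set.ncard_eq_one] at hm
    obtain ⟨a, ha⟩ := hm
    have hea : e ∈ ({a} : Set β) := ha ▸ (⟨hl.edge_mem, rfl⟩ : e ∈ G.colourClass c (c e))
    refine joined_empty_iff.1 ((hl.spans_iff).1
      ((h.spans_iff e hl.edge_mem ∅ (Set.empty_subset _)).2 ⟨hS, fun f hf hfe hc => ?_⟩))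
    have hfa : f ∈ ({a} : Set β) := ha ▸ (⟨hf, hc⟩ : f ∈ G.colourClass c (c e))
    exact hfe (hfa.trans hea.symm)
  rw [h1, h2, h3 x y, if_pos hS, if_pos hS]
  simp only [cyclePolynomial, Finset.sum_Ico_succ_top (Nat.le_add_left 1 m)]
  ring

/-- The product obeys every rule of the recursion. Induction on a derivation gives uniqueness for
any order of edges; induction on the number of edges gives existence. -/
lemma isTuttePolynomial_iff [Fintype ι] (h : G.IsCircuitSum c S) (hfin : G.edgeSet.Finite)
    {p : MvPolynomial (Fin 2) ℤ} :
    G.IsTuttePolynomial p ↔ p = G.circuitSumPolynomial c S := by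
  constructor
  · intro hp
    induction hp generalizing S with
    | edgeless G hG => exact (h.circuitSumPolynomial_of_edgeSet_eq_empty hG).symm
    | bridge G e p hb _ ih =>
      have he : e ∈ G.edgeSet := by obtain ⟨x, y, hxy, _⟩ := hb; exact hxy.edge_mem
      rw [h.circuitSumPolynomial_of_isBridge hfin he hb,
        ih (h.deleteEdges he) (hfin.subset fun _ ha => ha.1)]
    | loop G e x p hl _ ih =>
      have he : e ∈ G.edgeSet := hl.edge_mem
      rw [h.circuitSumPolynomial_of_isLoopAt hfin hl,
        ih (h.deleteEdges he) (hfin.subset fun _ ha => ha.1)]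
    | ordinary G e x y p q hl hne hb _ _ ih₁ ih₂ =>
      rw [h.circuitSumPolynomial_of_ordinary hfin hl hne hb,
        ih₁ (h.deleteEdges hl.edge_mem) (hfin.subset fun _ ha => ha.1),
        ih₂ (h.contractEdge hl hne) (hfin.subset fun _ ha => ha.1)]
  · rintro rfl
    induction hm : G.edgeSet.ncard generalizing G S with
    | zero =>
      have hG : G.edgeSet = ∅ := (Set.ncard_eq_zero hfin).1 hm
      rw [h.circuitSumPolynomial_of_edgeSet_eq_empty hG]
      exact .edgeless G hG
    | succ m ih =>
      obtain ⟨e, he⟩ : G.edgeSet.Nonempty :=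
        Set.nonempty_of_ncard_ne_zero (by rw [hm]; exact m.succ_ne_zero)
      have hcard : (G.edgeSet \ {e}).ncard = m := by
        rw [Set.ncard_sdiff_singleton_of_mem he, hm, Nat.add_sub_cancel]
      have hdel := ih (h.deleteEdges he) (hfin.subset fun _ ha => ha.1) hcard
      obtain ⟨x, y, hxy⟩ := exists_isLink_of_mem_edgeSet he
      by_cases hb : G.IsBridge e
      · rw [h.circuitSumPolynomial_of_isBridge hfin he hb]
        exact .bridge G e _ hb hdel
      by_cases hne : x = y
      · subst hne
        rw [h.circuitSumPolynomial_of_isLoopAt hfin hxy]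
        exact .loop G e x _ hxy hdel
      · rw [h.circuitSumPolynomial_of_ordinary hfin hxy hne hb]
        exact .ordinary G e x y _ _ hxy hne hb hdel
          (ih (h.contractEdge hxy hne) (hfin.subset fun _ ha => ha.1) hcard)

end IsCircuitSum

end Graph

/-! ### Orbits of an oriented edge, and retractions onto them. -/

namespace SimpleGraph

variable {V : Type*}

lemma EdgeOrientation.adj_arc {G : SimpleGraph V} (o : G.EdgeOrientation) (e : G.edgeSet) :
    G.Adj (o.arc e).1 (o.arc e).2 := by
  rw [← mem_edgeSet, o.mk_arc e]
  exact e.2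

lemma EdgeOrientation.arc_ne {G : SimpleGraph V} (o : G.EdgeOrientation) (e : G.edgeSet) :
    (o.arc e).2 ≠ (o.arc e).1 := (o.adj_arc e).ne'

/-- Deleting an edge of an acyclic graph separates its two ends. -/
lemma IsAcyclic.exists_side {G : SimpleGraph V} (hG : G.IsAcyclic) (o : G.EdgeOrientation)
    (e : G.edgeSet) : ∃ π : V → V, π (o.arc e).1 = (o.arc e).1 ∧ π (o.arc e).2 = (o.arc e).2 ∧
      ∀ f ≠ e, π (o.arc f).1 = π (o.arc f).2 := by
  classical
  have hb : ¬ (G.deleteEdges {(e : Sym2 V)}).Reachable (o.arc e).1 (o.arc e).2 := by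
    have := isAcyclic_iff_forall_isBridge.1 hG e.2
    rwa [← o.mk_arc e, isBridge_iff, o.mk_arc e] at this
  -- Each vertex goes to the end of `e` on its side. Every other edge survives the deletion, so its
  -- ends lie on the same side.
  refine ⟨fun v => if (G.deleteEdges {(e : Sym2 V)}).Reachable (o.arc e).1 v then (o.arc e).1
    else (o.arc e).2, if_pos (Reachable.refl _), if_neg hb, fun f hf => ?_⟩
  have hadj : (G.deleteEdges {(e : Sym2 V)}).Adj (o.arc f).1 (o.arc f).2 := by
    rw [deleteEdges_adj, o.mk_arc f]
    exact ⟨o.adj_arc f, fun h => hf (Subtype.ext h)⟩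
  have : (G.deleteEdges {(e : Sym2 V)}).Reachable (o.arc e).1 (o.arc f).1 ↔
      (G.deleteEdges {(e : Sym2 V)}).Reachable (o.arc e).1 (o.arc f).2 :=
    ⟨fun h => h.trans hadj.reachable, fun h => h.trans hadj.symm.reachable⟩
  simp only [this]

variable [DecidableEq V]

/-- The word obtained by replacing every letter of the longest prefix over `{a, b}` by `a`. -/
def prefixRep (a b : V) : ∀ n : ℕ, (Fin n → V) → (Fin n → V)
  | 0, w => w
  | n + 1, w => if w 0 = a ∨ w 0 = b then Fin.cons a (prefixRep a b n (Fin.tail w)) else w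

lemma prefixRep_cons (a b : V) {n : ℕ} (z : V) (w : Fin n → V) :
    prefixRep a b (n + 1) (Fin.cons z w : Fin (n + 1) → V) =
      if z = a ∨ z = b then Fin.cons a (prefixRep a b n w) else Fin.cons z w := by
  simp [prefixRep]

variable {G : SimpleGraph V} (o : G.EdgeOrientation)

lemma act_none {n : ℕ} (w : Fin n → V) : (graphAutomaton o).act n none w = w := by
  induction n with
  | zero => rfl
  | succ n ih =>
    change Fin.cons (w 0) ((graphAutomaton o).act n none (Fin.tail w)) = w
    rw [ih, Fin.cons_self_tail]

/-- The action of an oriented edge on the words of length `n`. -/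
def edgeAct {n : ℕ} (e : G.edgeSet) : (Fin n → V) → (Fin n → V) :=
  (graphAutomaton o).act n (some e)

lemma edgeAct_cons {n : ℕ} (e : G.edgeSet) (z : V) (w : Fin n → V) :
    edgeAct o e (Fin.cons z w : Fin (n + 1) → V) =
      if z = (o.arc e).1 then Fin.cons (o.arc e).2 (edgeAct o e w)
      else if z = (o.arc e).2 then Fin.cons (o.arc e).1 w else Fin.cons z w := by
  change (Fin.cons (if z = (o.arc e).1 then (o.arc e).2
    else if z = (o.arc e).2 then (o.arc e).1 else z)
    ((graphAutomaton o).act n (if z = (o.arc e).1 then some e else none) w) :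
      Fin (n + 1) → V) = _
  split_ifs
  · rfl
  · rw [act_none]
  · rw [act_none]

lemma edgeAct_injective {n : ℕ} (e : G.edgeSet) :
    Function.Injective (edgeAct o e : (Fin n → V) → (Fin n → V)) := by
  induction n with
  | zero => exact Function.injective_of_subsingleton _
  | succ n ih =>
    intro u v
    have hne := o.arc_ne e
    induction u using Fin.consCases with | _ z w
    induction v using Fin.consCases with | _ z' w'
    rw [edgeAct_cons, edgeAct_cons]
    intro h
    split_ifs at h with h1 h2 h3 h4 h5 h6 h7 h8 <;> rw [Fin.cons_inj] at h ⊢ <;>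
      grind [Function.Injective]

lemma prefixRep_edgeAct {n : ℕ} (e : G.edgeSet) (w : Fin n → V) :
    prefixRep (o.arc e).1 (o.arc e).2 n (edgeAct o e w) =
      prefixRep (o.arc e).1 (o.arc e).2 n w := by
  induction n with
  | zero => exact Subsingleton.elim _ _
  | succ n ih =>
    induction w using Fin.consCases with | _ z w
    rw [edgeAct_cons]
    split_ifs with h1 h2
    · simp [prefixRep_cons, h1, ih]
    · simp [prefixRep_cons, h2]
    · rfl

/-- The adding machine: two steps restore the first letter and carry once into the tail. -/
lemma edgeAct_iterate_two_mul_cons_fst {n : ℕ} (e : G.edgeSet) (w : Fin n → V) (j : ℕ) :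
    (edgeAct o e)^[2 * j] (Fin.cons (o.arc e).1 w : Fin (n + 1) → V) =
      Fin.cons (o.arc e).1 ((edgeAct o e)^[j] w) := by
  induction j with
  | zero => rfl
  | succ j ih =>
    rw [show 2 * (j + 1) = 2 + 2 * j by ring, Function.iterate_add_apply, ih,
      Function.iterate_succ_apply' _ j]
    simp [edgeAct_cons, o.arc_ne e]

/-- With the invariance `prefixRep_edgeAct`, this makes `prefixRep` a complete invariant of the
orbits. -/
lemma exists_iterate_edgeAct_eq {n : ℕ} (e : G.edgeSet) (w w' : Fin n → V)
    (h : prefixRep (o.arc e).1 (o.arc e).2 n w = prefixRep (o.arc e).1 (o.arc e).2 n w') :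
    ∃ j, (edgeAct o e)^[j] w = w' := by
  induction n with
  | zero => exact ⟨0, Subsingleton.elim _ _⟩
  | succ n ih =>
    have hne := o.arc_ne e
    -- From a word beginning with the source of `e`, targets with that first letter are reached at
    -- even times and those beginning with the other end at odd times.
    have key : ∀ (w : Fin n → V) (v : Fin (n + 1) → V),
        prefixRep (o.arc e).1 (o.arc e).2 (n + 1) (Fin.cons (o.arc e).1 w : Fin (n + 1) → V) =
          prefixRep (o.arc e).1 (o.arc e).2 (n + 1) v →
        ∃ j, (edgeAct o e)^[j] (Fin.cons (o.arc e).1 w : Fin (n + 1) → V) = v := by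
      intro w v h
      induction v using Fin.consCases with | _ z v
      rw [prefixRep_cons, if_pos (Or.inl rfl), prefixRep_cons] at h
      split_ifs at h with hz
      · have hw := (Fin.cons_inj.1 h).2
        rcases hz with rfl | rfl
        · obtain ⟨j, rfl⟩ := ih w v hw
          exact ⟨2 * j, edgeAct_iterate_two_mul_cons_fst o e w j⟩
        · obtain ⟨j, hj⟩ := ih (edgeAct o e w) v ((prefixRep_edgeAct o e w).trans hw)
          refine ⟨2 * j + 1, ?_⟩
          rw [Function.iterate_succ_apply', edgeAct_iterate_two_mul_cons_fst, edgeAct_cons,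
            if_pos rfl, ← hj, ← Function.iterate_succ_apply, Function.iterate_succ_apply']
      · exact absurd (Or.inl (Fin.cons_inj.1 h).1.symm) hz
    induction w using Fin.consCases with | _ z w
    by_cases hz : z = (o.arc e).1
    · subst hz; exact key w w' h
    by_cases hz' : z = (o.arc e).2
    · subst hz'
      have hstep : edgeAct o e (Fin.cons (o.arc e).2 w : Fin (n + 1) → V) =
          Fin.cons (o.arc e).1 w := by
        rw [edgeAct_cons, if_neg hne, if_pos rfl]
      obtain ⟨j, hj⟩ := key w w' (by rw [← hstep, prefixRep_edgeAct, h])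
      exact ⟨j + 1, by rw [Function.iterate_succ_apply, hstep, hj]⟩
    · refine ⟨0, ?_⟩
      induction w' using Fin.consCases with | _ y w'
      rw [prefixRep_cons, if_neg (by tauto), prefixRep_cons] at h
      split_ifs at h with hy
      · exact absurd (Fin.cons_inj.1 h).1 hz
      · exact h

lemma head_eq_of_edgeAct_ne {n : ℕ} (f : G.edgeSet) (w : Fin n → V) (h : edgeAct o f w ≠ w)
    (d : V) : (if hn : 0 < n then w ⟨0, hn⟩ else d) = (o.arc f).1 ∨
      (if hn : 0 < n then w ⟨0, hn⟩ else d) = (o.arc f).2 := by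
  cases n with
  | zero => exact absurd (Subsingleton.elim _ _) h
  | succ n =>
    induction w using Fin.consCases with | _ z w
    rw [edgeAct_cons] at h
    rw [dif_pos n.succ_pos]
    change z = _ ∨ z = _
    by_contra! hz
    exact h (by rw [if_neg hz.1, if_neg hz.2])

/-- The words can be retracted onto an orbit of an edge of a tree such that only the edges of that
orbit are not contracted to a point. -/
lemma IsAcyclic.exists_orbit_retraction (hG : G.IsAcyclic) {n : ℕ} (e : G.edgeSet)
    (r : Fin n → V) : ∃ φ : (Fin n → V) → (Fin n → V),
      (∀ u, prefixRep (o.arc e).1 (o.arc e).2 n u = r → φ u = u) ∧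
      ∀ f u, (f = e → prefixRep (o.arc e).1 (o.arc e).2 n u ≠ r) →
        φ (edgeAct o f u) = φ u := by
  induction n with
  | zero => exact ⟨id, fun _ _ => rfl, fun _ _ _ => Subsingleton.elim _ _⟩
  | succ n ih =>
    induction r using Fin.consCases with | _ z r
    by_cases hz : z = (o.arc e).1
    · subst hz
      obtain ⟨φ, hφ, hφ'⟩ := ih r
      obtain ⟨π, hπ₁, hπ₂, hπ⟩ := hG.exists_side o e
      set R : (Fin n → V) → (Fin n → V) := prefixRep (o.arc e).1 (o.arc e).2 n with hR
      let hd : (Fin n → V) → V := fun w => if hn : 0 < n then w ⟨0, hn⟩ else (o.arc e).1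
      -- Over a tail in the orbit `r`, the first letter is projected to its side of `e`. Over any
      -- other tail it is discarded and replaced by the side of the first letter of `φ` of the tail,
      -- which is where that part of the graph is attached.
      let Φ : (Fin (n + 1) → V) → (Fin (n + 1) → V) := fun u =>
        Fin.cons (π (if R (Fin.tail u) = r then u 0 else hd (φ (Fin.tail u)))) (φ (Fin.tail u))
      have hΦ : ∀ z w, Φ (Fin.cons z w) =
          Fin.cons (π (if R w = r then z else hd (φ w))) (φ w) := fun z w => by
        simp only [Φ, Fin.tail_cons, Fin.cons_zero]
      refine ⟨Φ, fun u hu => ?_, fun f u hu => ?_⟩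
      · induction u using Fin.consCases with | _ z w
        rw [prefixRep_cons] at hu
        split_ifs at hu with hz
        · have hw : R w = r := (Fin.cons_inj.1 hu).2
          rw [hΦ, if_pos hw, hφ w hw]
          rcases hz with rfl | rfl
          · rw [hπ₁]
          · rw [hπ₂]
        · exact absurd (Or.inl (Fin.cons_inj.1 hu).1) hz
      · induction u using Fin.consCases with | _ z w
        by_cases hfe : f = e
        · subst hfe
          have hu := hu rfl
          rw [prefixRep_cons] at hu
          rw [edgeAct_cons]
          have hRw : R (edgeAct o f w) = R w := prefixRep_edgeAct o f w
          split_ifs with h1 h2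
          · have hw : R w ≠ r := by
              simpa [h1, ← hR] using hu
            rw [hΦ, hΦ, if_neg hw, hRw, if_neg hw, hφ' f w fun _ => hw]
          · have hw : R w ≠ r := by
              simpa [h2, ← hR] using hu
            rw [hΦ, hΦ, if_neg hw, if_neg hw]
          · rfl
        · have hπf := hπ f hfe
          have hφf : φ (edgeAct o f w) = φ w := hφ' f w fun h => absurd h hfe
          -- The two cases of `Φ` agree where `f` enters or leaves the orbit: a word moved by `f`
          -- begins with an end of `f`, and both ends are on the same side of `e`. The default
          -- letter in `hd` is harmless, as the empty word is never moved.
          have hhd : edgeAct o f w ≠ w → ∀ v, v = w ∨ v = edgeAct o f w →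
              π (hd v) = π (o.arc f).1 := by
            intro hne v hv
            have hv' : edgeAct o f v ≠ v := by
              rcases hv with rfl | rfl
              · exact hne
              · exact fun h => hne (edgeAct_injective o f h)
            rcases head_eq_of_edgeAct_ne o f v hv' (o.arc e).1 with h | h
            · exact congrArg π h
            · exact (congrArg π h).trans hπf.symm
          rw [edgeAct_cons]
          split_ifs with h1 h2
          · subst h1
            rw [hΦ, hΦ, hφf]
            congr 1
            by_cases hw : R w = r <;> by_cases hw' : R (edgeAct o f w) = r
            · rw [if_pos hw, if_pos hw', hπf]
            · rw [if_pos hw, if_neg hw', hφ w hw]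
              exact hhd (fun h => hw' ((congrArg R h).trans hw)) w (Or.inl rfl)
            · rw [if_neg hw, if_pos hw', ← hφf, hφ _ hw', ← hπf]
              exact (hhd (fun h => hw ((congrArg R h).symm.trans hw')) _ (Or.inr rfl)).symm
            · rw [if_neg hw, if_neg hw']
          · subst h2
            rw [hΦ, hΦ]
            congr 1
            split_ifs
            · exact hπf
            · rfl
          · rfl
    -- Here the fibre has at most one word, so a constant map is a retraction.
    · refine ⟨fun _ => Fin.cons z r, fun u hu => ?_, fun _ _ _ => rfl⟩
      induction u using Fin.consCases with | _ y w
      rw [prefixRep_cons] at hu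
      split_ifs at hu with hy
      · exact absurd (Fin.cons_inj.1 hu).1.symm hz
      · exact hu.symm

/-! ### The cycle matroid of the Schreier graph. -/

/-- The edges of the Schreier graph are coloured by the orbits of the oriented edges. -/
def orbitColour {n : ℕ} (p : G.edgeSet × (Fin n → V)) : G.edgeSet × (Fin n → V) :=
  (p.1, prefixRep (o.arc p.1).1 (o.arc p.1).2 n p.2)

lemma automatonSchreierGraph_isLink {n : ℕ} (e : G.edgeSet) (w : Fin n → V) :
    (automatonSchreierGraph o n).IsLink (e, w) w (edgeAct o e w) := rfl

lemma isCircuitSum_automatonSchreierGraph [Finite V] (hG : G.IsAcyclic) (n : ℕ) :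
    (automatonSchreierGraph o n).IsCircuitSum (orbitColour o) (Set.range (orbitColour o)) where
  exists_edge := by
    rintro _ ⟨p, rfl⟩
    exact ⟨p, Set.mem_univ _, rfl⟩
  spans_iff := by
    rintro ⟨e, w⟩ - A hA
    have hewA : (e, w) ∉ A := fun h => (hA h).2 rfl
    rw [(automatonSchreierGraph_isLink o e w).spans_iff]
    have hper := (edgeAct_injective o e).mem_periodicPts w
    have hpos := Function.minimalPeriod_pos_of_mem_periodicPts hper
    set m := Function.minimalPeriod (edgeAct o e) w with hm
    have hit : (edgeAct o e)^[m] w = w := Function.iterate_minimalPeriod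
    have hlt : ∀ i, 0 < i → i < m → (edgeAct o e)^[i] w ≠ w := fun i h0 hi h =>
      Function.not_isPeriodicPt_of_pos_of_lt_minimalPeriod h0.ne' hi h
    have hrep : ∀ i, prefixRep (o.arc e).1 (o.arc e).2 n ((edgeAct o e)^[i] w) =
        prefixRep (o.arc e).1 (o.arc e).2 n w := by
      intro i
      induction i with
      | zero => rfl
      | succ i ih => rw [Function.iterate_succ_apply', prefixRep_edgeAct, ih]
    constructor
    · refine fun hj => ⟨⟨_, rfl⟩, ?_⟩
      rintro ⟨e', w'⟩ - hne hc
      obtain rfl : e' = e := congrArg Prod.fst hc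
      replace hc := congrArg Prod.snd hc
      change prefixRep _ _ n w' = prefixRep _ _ n w at hc
      by_contra hw'A
      obtain ⟨j, hj'⟩ := exists_iterate_edgeAct_eq o e' w w' hc.symm
      obtain ⟨j, hjm, rfl⟩ : ∃ j < m, (edgeAct o e')^[j] w = w' :=
        ⟨j % m, Nat.mod_lt _ hpos, by rw [Function.iterate_mod_minimalPeriod_eq, hj']⟩
      have hj0 : 0 < j := by
        rcases Nat.eq_zero_or_pos j with rfl | h
        · exact absurd rfl hne
        · exact h
      obtain ⟨φ, hφ, hφ'⟩ := hG.exists_orbit_retraction o e'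
        (prefixRep (o.arc e').1 (o.arc e').2 n w)
      -- The edges at times `0` and `j` are both missing from `A` and cut the circuit into two arcs.
      -- `P` says that `φ` lands on the arc from time `1` to time `j`; no edge of `A` changes it,
      -- yet it separates `w` from its image.
      let P : (Fin n → V) → Prop := fun u => ∃ i, 1 ≤ i ∧ i ≤ j ∧ φ u = (edgeAct o e')^[i] w
      have hstep : ∀ f v, (f, v) ∈ A → (P v ↔ P (edgeAct o f v)) := by
        intro f v hfv
        by_cases hO : f = e' ∧
            prefixRep (o.arc e').1 (o.arc e').2 n v = prefixRep (o.arc e').1 (o.arc e').2 n w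
        · obtain ⟨rfl, hv⟩ := hO
          have h1 : φ v = v := hφ v hv
          have h2 : φ (edgeAct o f v) = edgeAct o f v :=
            hφ _ ((prefixRep_edgeAct o f v).trans hv)
          simp only [P, h1, h2]
          constructor
          · rintro ⟨i, hi1, hij, rfl⟩
            refine ⟨i + 1, by omega, ?_, (Function.iterate_succ_apply' _ _ _).symm⟩
            rcases hij.lt_or_eq with h | rfl
            · exact h
            · exact absurd hfv hw'A
          · rintro ⟨i, hi1, hij, hi⟩
            obtain ⟨i, rfl⟩ := Nat.exists_eq_add_of_le' hi1
            rw [Function.iterate_succ_apply'] at hi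
            have hi := edgeAct_injective o f hi
            subst hi
            refine ⟨i, ?_, by omega, rfl⟩
            rcases Nat.eq_zero_or_pos i with rfl | h
            · exact absurd hfv hewA
            · exact h
        · have := hφ' f v fun h h' => hO ⟨h, h'⟩
          simp only [P, this]
      have hinv : ∀ u, (automatonSchreierGraph o n).Joined A w u → (P w ↔ P u) := by
        intro u hu
        induction hu with
        | refl => rfl
        | @tail b c _ hs ih =>
          obtain ⟨⟨f, v⟩, hfA, hl⟩ := hs
          rw [ih]
          rcases hl.eq_and_eq_or_eq_and_eq (automatonSchreierGraph_isLink o f v) with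
            ⟨rfl, rfl⟩ | ⟨rfl, rfl⟩
          · exact hstep f _ hfA
          · exact (hstep f _ hfA).symm
      have hPe : P (edgeAct o e' w) := ⟨1, le_rfl, hj0, hφ _ (prefixRep_edgeAct o e' w)⟩
      obtain ⟨i, hi1, hij, hi⟩ := (hinv _ hj).2 hPe
      rw [hφ w rfl] at hi
      exact hlt i hi1 (hij.trans_lt hjm) hi.symm
    · rintro ⟨-, hall⟩
      -- The remaining edges of the orbit lead from the image of `w` around the circuit back to `w`.
      have hj : ∀ i, i + 1 ≤ m → (automatonSchreierGraph o n).Joined A (edgeAct o e w)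
          ((edgeAct o e)^[i + 1] w) := by
        intro i
        induction i with
        | zero => exact fun _ => .refl
        | succ i ih =>
          intro hi
          refine (ih (by omega)).trans ?_
          rw [Function.iterate_succ_apply' _ (i + 1)]
          refine (automatonSchreierGraph_isLink o e _).joined (hall _ (Set.mem_univ _) ?_ ?_)
          · exact fun h => hlt (i + 1) (by omega) (by omega) (congrArg Prod.snd h)
          · exact Prod.ext rfl (hrep (i + 1))
      have := hj (m - 1) (by omega)
      rw [Nat.sub_add_cancel hpos, hit] at this
      exact this.symm

end SimpleGraph

/-! ### Counting orbits by length. -/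

namespace SimpleGraph

variable {V : Type*} [DecidableEq V]

/-- A leading `a` comes from either `a` or `b`, which doubles the fibre; no value of `prefixRep`
begins with `b`; any other first letter leaves the word unchanged. -/
lemma ncard_setOf_prefixRep_eq_cons [Finite V] {a b : V} (hab : b ≠ a) {n : ℕ} (z : V)
    (r : Fin n → V) :
    {w | prefixRep a b (n + 1) w = Fin.cons z r}.ncard =
      if z = a then 2 * {w | prefixRep a b n w = r}.ncard else if z = b then 0 else 1 := by
  split_ifs with h1 h2
  · subst h1
    have hinj : ∀ c : V, Function.Injective fun w : Fin n → V =>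
        (Fin.cons c w : Fin (n + 1) → V) := fun c _ _ h =>
      (Fin.cons_inj.1 h).2
    have : {w | prefixRep z b (n + 1) w = Fin.cons z r} =
        (fun w : Fin n → V => (Fin.cons z w : Fin (n + 1) → V)) '' {w | prefixRep z b n w = r} ∪
        (fun w : Fin n → V => (Fin.cons b w : Fin (n + 1) → V)) ''
          {w | prefixRep z b n w = r} := by
      ext u
      induction u using Fin.consCases with | _ y w
      simp only [Set.mem_ofPred_eq, Set.mem_union, Set.mem_image, Fin.cons_inj, prefixRep_cons]
      constructor
      · intro h
        split_ifs at h with hy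
        · have hw := (Fin.cons_inj.1 h).2
          rcases hy with rfl | rfl
          · exact Or.inl ⟨w, hw, rfl, rfl⟩
          · exact Or.inr ⟨w, hw, rfl, rfl⟩
        · exact absurd (Or.inl (Fin.cons_inj.1 h).1) hy
      · rintro (⟨w, hw, rfl, rfl⟩ | ⟨w, hw, rfl, rfl⟩)
        · rw [if_pos (Or.inl rfl), hw]
        · rw [if_pos (Or.inr rfl), hw]
    rw [this, Set.ncard_union_eq, Set.ncard_image_of_injective _ (hinj z),
      Set.ncard_image_of_injective _ (hinj b), two_mul]
    rw [Set.disjoint_left]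
    rintro _ ⟨w, -, rfl⟩ ⟨w', -, h⟩
    exact hab (Fin.cons_inj.1 h).1
  · rw [Set.ncard_eq_zero]
    ext u
    induction u using Fin.consCases with | _ y w
    simp only [Set.mem_ofPred_eq, Set.mem_empty_iff_false, iff_false, prefixRep_cons]
    intro h
    split_ifs at h with hy
    · exact h1 (Fin.cons_inj.1 h).1.symm
    · exact hy (Or.inr ((Fin.cons_inj.1 h).1.trans h2))
  · rw [Set.ncard_eq_one]
    refine ⟨Fin.cons z r, ?_⟩
    ext u
    induction u using Fin.consCases with | _ y w
    simp only [Set.mem_ofPred_eq, Set.mem_singleton_iff, prefixRep_cons]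
    split_ifs with hy
    · constructor
      · exact fun h => absurd (Fin.cons_inj.1 h).1.symm h1
      · intro h
        rcases hy with rfl | rfl
        · exact absurd (Fin.cons_inj.1 h).1.symm h1
        · exact absurd (Fin.cons_inj.1 h).1.symm h2
    · rfl

/-- The product over the orbits of an edge of a function of the length of the orbit. -/
lemma prod_ncard_setOf_prefixRep_eq [Fintype V] {M : Type*} [CommMonoid M] {a b : V} (hab : b ≠ a)
    (n : ℕ) (ψ : ℕ → M) (hψ : ψ 0 = 1) :
    ∏ r, ψ {w | prefixRep a b n w = r}.ncard =
      ψ (2 ^ n) * ∏ i ∈ Finset.range n,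
        ψ (2 ^ i) ^ ((Fintype.card V - 2) * Fintype.card V ^ (n - i - 1)) := by
  -- The function `ψ` varies because fibres double under a leading `a`: the induction hypothesis is
  -- used for `m ↦ ψ (2 * m)`. The condition `ψ 0 = 1` discards the empty fibres.
  induction n generalizing ψ with
  | zero =>
    have : ∀ r : Fin 0 → V, {w | prefixRep a b 0 w = r} = {r} := fun r => by
      ext w
      simp [Subsingleton.elim w r, prefixRep]
    simp [this]
  | succ n ih =>
    rw [← (Fin.consEquiv fun _ : Fin (n + 1) => V).prod_comp, Fintype.prod_prod_type]
    have hmem : b ∈ Finset.univ.erase a := Finset.mem_erase.2 ⟨hab, Finset.mem_univ _⟩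
    have hz : ∀ z, ∏ r : Fin n → V,
        ψ {w | prefixRep a b (n + 1) w = Fin.consEquiv (fun _ : Fin (n + 1) => V) (z, r)}.ncard =
        if z = a then ∏ r, ψ (2 * {w | prefixRep a b n w = r}.ncard)
          else if z = b then 1 else ψ 1 ^ Fintype.card V ^ n := by
      intro z
      have : ∀ r : Fin n → V, Fin.consEquiv (fun _ : Fin (n + 1) => V) (z, r) =
        Fin.cons z r := fun r => rfl
      simp only [this, ncard_setOf_prefixRep_eq_cons hab]
      split_ifs <;> simp [hψ]
    simp only [hz]
    have hrest : ∏ z ∈ (Finset.univ.erase a).erase b,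
        (if z = a then ∏ r, ψ (2 * {w | prefixRep a b n w = r}.ncard)
          else if z = b then 1 else ψ 1 ^ Fintype.card V ^ n) =
        ∏ z ∈ (Finset.univ.erase a).erase b, ψ 1 ^ Fintype.card V ^ n := by
      refine Finset.prod_congr rfl fun z hz => ?_
      rw [Finset.mem_erase, Finset.mem_erase] at hz
      rw [if_neg hz.2.1, if_neg hz.1]
    rw [← Finset.mul_prod_erase _ _ (Finset.mem_univ a), ← Finset.mul_prod_erase _ _ hmem,
      if_pos rfl, if_neg hab, if_pos rfl, one_mul, hrest, Finset.prod_const,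
      Finset.card_erase_of_mem hmem, Finset.card_erase_of_mem (Finset.mem_univ a),
      Finset.card_univ, ih (fun m => ψ (2 * m)) hψ, Finset.prod_range_succ', mul_assoc]
    congr 1
    · rw [pow_succ']
    · congr 1
      · refine Finset.prod_congr rfl fun i hi => ?_
        rw [pow_succ', show n + 1 - (i + 1) - 1 = n - i - 1 by omega]
      · rw [← pow_mul, pow_zero, mul_comm]
        rfl

lemma ncard_colourClass_automatonSchreierGraph {G : SimpleGraph V} (o : G.EdgeOrientation)
    {n : ℕ} (e : G.edgeSet) (r : Fin n → V) :
    ((automatonSchreierGraph o n).colourClass (orbitColour o) (e, r)).ncard =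
      {w | prefixRep (o.arc e).1 (o.arc e).2 n w = r}.ncard := by
  rw [← Set.ncard_image_of_injective {w | prefixRep (o.arc e).1 (o.arc e).2 n w = r}
    (Prod.mk_right_injective e)]
  congr 1
  ext ⟨f, w⟩
  constructor
  · rintro ⟨-, h⟩
    obtain rfl : f = e := congrArg Prod.fst h
    exact ⟨w, congrArg Prod.snd h, rfl⟩
  · rintro ⟨w', hw, h⟩
    obtain rfl : e = f := congrArg Prod.fst h
    obtain rfl : w' = w := congrArg Prod.snd h
    exact ⟨Set.mem_univ _, Prod.ext rfl hw⟩

end SimpleGraph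

/-! ### Assembly of the formula. -/

theorem mainTheorem3 {V : Type*} [Fintype V] [DecidableEq V] (G : SimpleGraph V)
    (hG : G.IsTree) (o : G.EdgeOrientation) (k : ℕ) (hk : Fintype.card V = k) (hk2 : 2 ≤ k)
    (n : ℕ) (hn : 1 ≤ n) (p : MvPolynomial (Fin 2) ℤ) :
    (SimpleGraph.automatonSchreierGraph o n).IsTuttePolynomial p ↔
      p = MvPolynomial.X 1 ^ ((k - 1) * (k - 2) * k ^ (n - 1)) *
          cyclePolynomial (2 ^ n) ^ (k - 1) *
          ∏ i ∈ Finset.Ico 1 n,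
            cyclePolynomial (2 ^ i) ^ ((k - 1) * (k - 2) * k ^ (n - i - 1)) := by
  classical
  have hcard : Fintype.card G.edgeSet = k - 1 := by
    have h1 := hG.card_edgeFinset
    rw [SimpleGraph.edgeFinset_card] at h1
    omega
  rw [(SimpleGraph.isCircuitSum_automatonSchreierGraph o hG.isAcyclic n).isTuttePolynomial_iff
    (Set.toFinite _)]
  -- Each of the `k - 1` edges of the tree contributes the same factor. Its term `i = 0` collects
  -- the loops, at words whose first letter is not an end of the edge, and yields the power of `y`.
  suffices h : (SimpleGraph.automatonSchreierGraph o n).circuitSumPolynomial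
      (SimpleGraph.orbitColour o) (Set.range (SimpleGraph.orbitColour o)) =
      (cyclePolynomial (2 ^ n) * ∏ i ∈ Finset.range n,
        cyclePolynomial (2 ^ i) ^ ((k - 2) * k ^ (n - i - 1))) ^ (k - 1) by
    rw [h, Finset.range_eq_Ico, Finset.prod_eq_prod_Ico_succ_bot hn, mul_pow, mul_pow,
      ← Finset.prod_pow]
    have h1 : cyclePolynomial (2 ^ 0) = MvPolynomial.X 1 := by simp [cyclePolynomial]
    rw [h1, ← pow_mul, ← mul_assoc, mul_comm (cyclePolynomial (2 ^ n) ^ (k - 1))]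
    simp only [← pow_mul, Nat.sub_zero, zero_add, mul_comm _ (k - 1), mul_assoc]
  -- The value at `0` is set to `1` to match the factor `x ^ 0` of a colour that does not occur.
  let ψ : ℕ → MvPolynomial (Fin 2) ℤ := fun m => if m = 0 then 1 else cyclePolynomial m
  have hψ : ∀ i, ψ (2 ^ i) = cyclePolynomial (2 ^ i) := fun i => if_neg (by positivity)
  have hprod : ∀ e : G.edgeSet,
      ∏ r, ψ {w | SimpleGraph.prefixRep (o.arc e).1 (o.arc e).2 n w = r}.ncard =
        cyclePolynomial (2 ^ n) * ∏ i ∈ Finset.range n,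
          cyclePolynomial (2 ^ i) ^ ((k - 2) * k ^ (n - i - 1)) := fun e => by
    rw [SimpleGraph.prod_ncard_setOf_prefixRep_eq (o.arc_ne e) n ψ rfl, hk]
    simp only [hψ]
  calc _ = ∏ p : G.edgeSet × (Fin n → V),
        ψ {w | SimpleGraph.prefixRep (o.arc p.1).1 (o.arc p.1).2 n w = p.2}.ncard := by
        refine Finset.prod_congr rfl ?_
        rintro ⟨e, r⟩ -
        rw [SimpleGraph.ncard_colourClass_automatonSchreierGraph]
        change _ = ite _ _ _
        have : {w | SimpleGraph.prefixRep (o.arc e).1 (o.arc e).2 n w = r}.ncard = 0 ↔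
            (e, r) ∉ Set.range (SimpleGraph.orbitColour o) := by
          rw [Set.ncard_eq_zero, Set.eq_empty_iff_forall_notMem]
          constructor
          · rintro h ⟨⟨f, w⟩, hw⟩
            obtain rfl : f = e := congrArg Prod.fst hw
            exact h w (congrArg Prod.snd hw)
          · exact fun h w hw => h ⟨(e, w), Prod.ext rfl hw⟩
        by_cases hr : (e, r) ∈ Set.range (SimpleGraph.orbitColour o)
        · rw [if_pos hr, if_neg fun h => this.1 h hr]
        · rw [if_neg hr, if_pos (this.2 hr), this.2 hr, pow_zero]
    _ = _ := by
        rw [Fintype.prod_prod_type]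
        simp only [hprod]
        rw [Finset.prod_const, Finset.card_univ, hcard]
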